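/- For a commutative ring $R$ and $r\in R$, a $D(r)$ triple over $R$ is a triple $(a_1,a_2,a_3)\in R^3$ (entries need not be distinct) such that $a_ia_j+r$ is a square in $R$ for all $1\le i<j\le 3$. Let $K_1,K_2,\ldots$ be a sequence of non-archimedean local fields of characteristic $0$, let $\mathcal{O}_{K_i}$ be the valuation ring of $K_i$ and let $p_i$ be the residue characteristic of $K_i$, and suppose that $p_i\to\infty$ as $i\to\infty$. Let $r\neq 0$ be a fixed integer, viewed in each $\mathcal{O}_{K_i}$. Let $\mathrm{diop}_3^r(\mathcal{O}_{K_i})$ denote the measure of the set of $D(r)$ triples over $\mathcal{O}_{K_i}$ with respect to the product measure on $\mathcal{O}_{K_i}^3$ of the Haar measure on $\mathcal{O}_{K_i}$ normalized to have total mass $1$. Then, as $i\to\infty$, $$\mathrm{diop}_3^r(\mathcal{O}_{K_i})=\frac18+O\left(\frac1{p_i}\right).$$ -/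

import Mathlib

open MeasureTheory ValuativeRel

/-- The set of `D(r)` `m`-tuples over `R`: the `(a₁, …, aₘ) ∈ Rᵐ` (repetitions allowed) such that
`aᵢ aⱼ + r` is a square in `R` for all `i < j`. -/
def diophTuples (m : ℕ) (R : Type*) [CommRing R] (r : R) : Set (Fin m → R) :=
  {a | ∀ i j : Fin m, i < j → IsSquare (a i * a j + r)}

/-- The measure of the set of `D(r)` `m`-tuples over a compact topological ring `R`, for the product
measure on `Rᵐ` of the Haar measure of the additive group of `R`, normalized so that `R` has
measure `1`. -/
noncomputable def diophMeasure (m : ℕ) (R : Type*) [CommRing R] [TopologicalSpace R]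
    [IsTopologicalRing R] [CompactSpace R] (r : R) : ℝ :=
  letI : MeasurableSpace R := borel R
  haveI : BorelSpace R := ⟨rfl⟩
  (Measure.pi fun _ : Fin m => Measure.addHaarMeasure (⊤ : TopologicalSpace.PositiveCompacts R)).real
    (diophTuples m R r)

/-!
Once the residue characteristic is odd and larger than `|r|`, so that `r` is a unit, Hensel's lemma
shows that whether `aᵢ aⱼ + r` is a square depends only on the residues of `aᵢ` and `aⱼ`, unless
`aᵢ aⱼ + r` is a nonunit, which has probability at most `1 / q` for a residue field with `q`
elements. Hence the measure of the set of `D(r)` triples is within `O(1 / q)` of the proportion of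
`D(r)` triples over the residue field.

Over a field `F` with `q` elements and quadratic character `χ`, eight times the number of `D(r)`
triples is `∑ a, b, c, (1 + χ (a b + r)) (1 + χ (a c + r)) (1 + χ (b c + r))` up to `O(q²)`. Since
`∑ c, χ (a c + r) χ (b c + r)` is a Jacobi sum, equal to `-χ (a b)`, when `a ≠ b`, summing over `c`
gives `q + O(1)` for all pairs `(a, b)` except `O(q)` of them, and the total is `q³ + O(q²)`.
-/

section QuadraticCharacterSums

variable {F : Type*} [Field F] [Fintype F] [DecidableEq F]

lemma abs_quadraticChar_le_one (x : F) : |quadraticChar F x| ≤ 1 := by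
  rcases quadraticChar_isQuadratic F x with h | h | h <;> simp [h]

lemma abs_sum_quadraticChar_le_card (f : F → F) :
    |∑ x, quadraticChar F (f x)| ≤ Fintype.card F := by
  simpa using (Finset.abs_sum_le_sum_abs _ _).trans
    (Finset.sum_le_card_nsmul Finset.univ _ 1 fun x _ => abs_quadraticChar_le_one (f x))

lemma sum_quadraticChar_mul_add_eq_zero (hF : ringChar F ≠ 2) {b : F} (hb : b ≠ 0) (s : F) :
    ∑ x, quadraticChar F (b * x + s) = 0 := by
  rw [← quadraticChar_sum_zero hF]
  exact ((Equiv.mulLeft₀ b hb).trans (Equiv.addRight s)).sum_comp (quadraticChar F)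

lemma sum_quadraticChar_mul_one_sub (hF : ringChar F ≠ 2) :
    ∑ x, quadraticChar F x * quadraticChar F (1 - x) = -quadraticChar F (-1) := by
  have h := jacobiSum_nontrivial_inv (quadraticChar_ne_one hF)
  rwa [(quadraticChar_isQuadratic F).inv] at h

lemma sum_quadraticChar_mul_add_mul_quadraticChar_mul_add (hF : ringChar F ≠ 2) {b c s t : F}
    (h : b * t - c * s ≠ 0) :
    ∑ x, quadraticChar F (b * x + s) * quadraticChar F (c * x + t) = -quadraticChar F (b * c) := by
  rcases eq_or_ne b 0 with rfl | hb
  · have hc : c ≠ 0 := by rintro rfl; simp at h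
    simp only [zero_mul, zero_add, ← Finset.mul_sum, sum_quadraticChar_mul_add_eq_zero hF hc,
      mul_zero, quadraticChar_zero, neg_zero]
  rcases eq_or_ne c 0 with rfl | hc
  · simp only [zero_mul, zero_add, ← Finset.sum_mul, sum_quadraticChar_mul_add_eq_zero hF hb,
      mul_zero, quadraticChar_zero, neg_zero]
  set d := b * t - c * s with hd
  -- The affine change of variable `x ↦ -c (b x + s) / d` turns the summand into that of `J(χ, χ)`.
  have hsubst : ∑ x, quadraticChar F (-c / d * (b * x + s)) *
      quadraticChar F (1 - -c / d * (b * x + s)) = -quadraticChar F (-1) := by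
    rw [← sum_quadraticChar_mul_one_sub hF]
    exact (((Equiv.mulLeft₀ b hb).trans (Equiv.addRight s)).trans
      (Equiv.mulLeft₀ (-c / d) (div_ne_zero (neg_ne_zero.2 hc) h))).sum_comp
        fun y => quadraticChar F y * quadraticChar F (1 - y)
  have hsummand (x : F) : quadraticChar F (b * x + s) * quadraticChar F (c * x + t) =
      quadraticChar F (-(b * c)) * (quadraticChar F (-c / d * (b * x + s)) *
        quadraticChar F (1 - -c / d * (b * x + s))) := by
    have hsq : quadraticChar F ((b * c / d) ^ 2) = 1 :=
      quadraticChar_sq_one' (div_ne_zero (mul_ne_zero hb hc) h)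
    rw [← map_mul, ← one_mul (quadraticChar F _), ← hsq, ← map_mul, ← map_mul, ← map_mul]
    congr 1
    field_simp
    rw [hd]
    ring
  rw [Finset.sum_congr rfl fun x _ => hsummand x, ← Finset.mul_sum, hsubst, mul_neg, ← map_mul,
    neg_mul_neg, mul_one]

lemma abs_sum_quadraticChar_mul_add_le (hF : ringChar F ≠ 2) (b s : F) :
    |∑ x, quadraticChar F (b * x + s)| ≤ if b = 0 then (Fintype.card F : ℤ) else 0 := by
  split_ifs with hb
  · exact abs_sum_quadraticChar_le_card _
  · rw [sum_quadraticChar_mul_add_eq_zero hF hb, abs_zero]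

lemma abs_sum_quadraticChar_mul_quadraticChar_le (hF : ringChar F ≠ 2) {r : F} (hr : r ≠ 0)
    (b c : F) :
    |∑ x, quadraticChar F (b * x + r) * quadraticChar F (c * x + r)| ≤
      1 + if b = c then (Fintype.card F : ℤ) else 0 := by
  split_ifs with hbc
  · simp only [← map_mul]
    exact (abs_sum_quadraticChar_le_card _).trans (by simp)
  · have h : b * r - c * r ≠ 0 := by
      rw [← sub_mul]
      exact mul_ne_zero (sub_ne_zero.2 hbc) hr
    rw [sum_quadraticChar_mul_add_mul_quadraticChar_mul_add hF h, abs_neg, add_zero]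
    exact abs_quadraticChar_le_one _

lemma abs_sum_one_add_quadraticChar_mul_sub_card_le (hF : ringChar F ≠ 2) {r : F} (hr : r ≠ 0)
    (b c : F) :
    |∑ x, (1 + quadraticChar F (b * x + r)) * (1 + quadraticChar F (c * x + r)) -
        Fintype.card F| ≤
      (if b = 0 then (Fintype.card F : ℤ) else 0) + (if c = 0 then (Fintype.card F : ℤ) else 0) +
        (1 + if b = c then (Fintype.card F : ℤ) else 0) := by
  have expand : ∑ x, (1 + quadraticChar F (b * x + r)) * (1 + quadraticChar F (c * x + r)) -
      Fintype.card F = ∑ x, quadraticChar F (b * x + r) + ∑ x, quadraticChar F (c * x + r) +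
        ∑ x, quadraticChar F (b * x + r) * quadraticChar F (c * x + r) := by
    simp only [add_mul, mul_add, one_mul, mul_one, Finset.sum_add_distrib, Finset.sum_const,
      Finset.card_univ, nsmul_eq_mul]
    ring
  rw [expand]
  exact (abs_add_three _ _ _).trans <| add_le_add_three
    (abs_sum_quadraticChar_mul_add_le hF b r) (abs_sum_quadraticChar_mul_add_le hF c r)
    (abs_sum_quadraticChar_mul_quadraticChar_le hF hr b c)

end QuadraticCharacterSums

section DiophTuplesOverFiniteField

/-- The `D(r)` `m`-tuples over `R` all of whose values `aᵢ aⱼ + r`, for `i < j`, are units. Over a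
Henselian local ring of odd residue characteristic, Hensel's lemma lifts these tuples from the
residue field. -/
def unitDiophTuples (m : ℕ) (R : Type*) [CommRing R] (r : R) : Set (Fin m → R) :=
  {a | ∀ i j : Fin m, i < j → IsUnit (a i * a j + r) ∧ IsSquare (a i * a j + r)}

lemma unitDiophTuples_subset_diophTuples (m : ℕ) {R : Type*} [CommRing R] (r : R) :
    unitDiophTuples m R r ⊆ diophTuples m R r :=
  fun _ ha i j hij => (ha i j hij).2

lemma forall_lt_fin_three {P : Fin 3 → Fin 3 → Prop} :
    (∀ i j, i < j → P i j) ↔ P 0 1 ∧ P 0 2 ∧ P 1 2 := by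
  simp [Fin.forall_fin_succ, and_assoc]

variable {F : Type*} [Field F]

lemma natCard_mul_ncard_setOf_mul_add_eq_zero_le [Finite F] {ι : Type*} [Finite ι] {i j : ι}
    (hij : i ≠ j) {r : F} (hr : r ≠ 0) :
    Nat.card F * {x : ι → F | x i * x j + r = 0}.ncard ≤ Nat.card F ^ Nat.card ι := by
  classical
  have hinj : Set.InjOn (fun (x : ι → F) (k : {k // k ≠ j}) => x k) {x | x i * x j + r = 0} := by
    intro x hx y hy hxy
    have hne (k : ι) (hk : k ≠ j) : x k = y k := congrFun hxy ⟨k, hk⟩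
    have hxi : x i ≠ 0 := by
      intro h
      simp [h, hr] at hx
    ext k
    rcases eq_or_ne k j with rfl | hk
    · refine mul_left_cancel₀ hxi (add_right_cancel (b := r) ?_)
      rw [hx, hne i hij, hy]
    · exact hne k hk
  have hle := Set.ncard_le_ncard_of_injOn _ (fun _ _ => Set.mem_univ _) hinj
  calc Nat.card F * {x : ι → F | x i * x j + r = 0}.ncard
      ≤ Nat.card F * Nat.card ({k // k ≠ j} → F) := by
        rw [Set.ncard_univ] at hle
        gcongr
    _ = Nat.card F ^ Nat.card ι := by
        rw [← Nat.card_prod, ← Nat.card_congr (Equiv.funSplitAt j F), Nat.card_fun]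

lemma natCard_mul_ncard_diophTuples_sdiff_le [Finite F] (m : ℕ) {r : F} (hr : r ≠ 0) :
    Nat.card F * (diophTuples m F r \ unitDiophTuples m F r).ncard ≤
      m.choose 2 * Nat.card F ^ m := by
  let pairs : Finset (Fin m × Fin m) := {p | p.1 < p.2}
  have hsub : diophTuples m F r \ unitDiophTuples m F r ⊆
      ⋃ p ∈ pairs, {x | x p.1 * x p.2 + r = 0} := by
    rintro x ⟨hx, hx'⟩
    simp only [unitDiophTuples, Set.mem_ofPred_eq, not_forall, not_and'] at hx'
    obtain ⟨i, j, hij, h⟩ := hx'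
    refine Set.mem_biUnion (x := (i, j)) (by simpa [pairs] using hij) ?_
    simpa using h (hx i j hij)
  calc Nat.card F * (diophTuples m F r \ unitDiophTuples m F r).ncard
      ≤ Nat.card F * ∑ p ∈ pairs, {x : Fin m → F | x p.1 * x p.2 + r = 0}.ncard := by
        gcongr
        exact (Set.ncard_le_ncard hsub).trans (pairs.set_ncard_biUnion_le _)
    _ ≤ ∑ _p ∈ pairs, Nat.card F ^ m := by
        rw [Finset.mul_sum]
        refine Finset.sum_le_sum fun p hp => ?_
        simpa using natCard_mul_ncard_setOf_mul_add_eq_zero_le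
          (ne_of_lt (Finset.mem_filter.1 hp).2) hr
    _ = m.choose 2 * Nat.card F ^ m := by
        rw [Finset.sum_const, smul_eq_mul]
        simp [pairs, Fintype.card_product_filter_lt]

section Weight

variable [Fintype F] [DecidableEq F]

/-- For `F` of odd characteristic, the number of `(x, y, z)` with `x² = a₀ a₁ + r`, `y² = a₀ a₂ + r`
and `z² = a₁ a₂ + r`, because `u : F` has `1 + χ u` square roots. Its sum over `a`, which character
sums evaluate, replaces the number of `D(r)` triples. -/
def diophWeight (r : F) (a : Fin 3 → F) : ℤ :=
  (1 + quadraticChar F (a 0 * a 1 + r)) * (1 + quadraticChar F (a 0 * a 2 + r)) *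
    (1 + quadraticChar F (a 1 * a 2 + r))

lemma one_add_quadraticChar_mem_Icc (u : F) : 1 + quadraticChar F u ∈ Set.Icc 0 2 := by
  have h := abs_le.1 (abs_quadraticChar_le_one u)
  constructor <;> linarith [h.1, h.2]

lemma diophWeight_nonneg (r : F) (a : Fin 3 → F) : 0 ≤ diophWeight r a :=
  mul_nonneg (mul_nonneg (one_add_quadraticChar_mem_Icc _).1 (one_add_quadraticChar_mem_Icc _).1)
    (one_add_quadraticChar_mem_Icc _).1

lemma diophWeight_le_eight (r : F) (a : Fin 3 → F) : diophWeight r a ≤ 8 := by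
  have h (u : F) := one_add_quadraticChar_mem_Icc u
  calc diophWeight r a ≤ 2 * 2 * 2 :=
        mul_le_mul (mul_le_mul (h _).2 (h _).2 (h _).1 (by norm_num)) (h _).2 (h _).1 (by norm_num)
    _ = 8 := by norm_num

lemma diophWeight_eq_eight {r : F} {a : Fin 3 → F} (ha : a ∈ unitDiophTuples 3 F r) :
    diophWeight r a = 8 := by
  have h (i j : Fin 3) (hij : i < j) : quadraticChar F (a i * a j + r) = 1 :=
    (quadraticChar_one_iff_isSquare (ha i j hij).1.ne_zero).2 (ha i j hij).2
  obtain ⟨h01, h02, h12⟩ := forall_lt_fin_three.1 h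
  norm_num [diophWeight, h01, h02, h12]

lemma diophWeight_eq_zero {r : F} {a : Fin 3 → F} (ha : a ∉ diophTuples 3 F r) :
    diophWeight r a = 0 := by
  have h : ¬(IsSquare (a 0 * a 1 + r) ∧ IsSquare (a 0 * a 2 + r) ∧ IsSquare (a 1 * a 2 + r)) :=
    fun h => ha (forall_lt_fin_three.2 h)
  simp only [← quadraticChar_neg_one_iff_not_isSquare, not_and_or] at h
  rcases h with h | h | h <;> simp [diophWeight, h]

lemma eight_mul_ncard_unitDiophTuples_le_sum_diophWeight (r : F) :
    8 * ((unitDiophTuples 3 F r).ncard : ℤ) ≤ ∑ a, diophWeight r a := by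
  classical
  calc 8 * ((unitDiophTuples 3 F r).ncard : ℤ)
      = ∑ a ∈ (unitDiophTuples 3 F r).toFinset, diophWeight r a := by
        rw [Finset.sum_congr rfl fun a ha => diophWeight_eq_eight (Set.mem_toFinset.1 ha),
          Finset.sum_const, nsmul_eq_mul, mul_comm, Set.ncard_eq_toFinset_card']
    _ ≤ ∑ a, diophWeight r a :=
        Finset.sum_le_univ_sum_of_nonneg fun a => diophWeight_nonneg r a

lemma sum_diophWeight_le_eight_mul_ncard_diophTuples (r : F) :
    ∑ a, diophWeight r a ≤ 8 * ((diophTuples 3 F r).ncard : ℤ) := by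
  classical
  calc ∑ a, diophWeight r a = ∑ a ∈ (diophTuples 3 F r).toFinset, diophWeight r a :=
        (Finset.sum_subset (Finset.subset_univ _) fun a _ ha =>
          diophWeight_eq_zero fun h => ha (Set.mem_toFinset.2 h)).symm
    _ ≤ (diophTuples 3 F r).toFinset.card • (8 : ℤ) :=
        Finset.sum_le_card_nsmul _ _ _ fun a _ => diophWeight_le_eight r a
    _ = 8 * ((diophTuples 3 F r).ncard : ℤ) := by
        rw [nsmul_eq_mul, mul_comm, Set.ncard_eq_toFinset_card']

lemma sum_fin_three_arrow {α M : Type*} [Fintype α] [AddCommMonoid M] (f : α → α → α → M) :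
    ∑ x : Fin 3 → α, f (x 0) (x 1) (x 2) = ∑ a, ∑ b, ∑ c, f a b c := by
  let e : α × α × α ≃ (Fin 3 → α) :=
    ((Equiv.refl α).prodCongr (finTwoArrowEquiv α).symm).trans (Fin.consEquiv fun _ => α)
  rw [← e.sum_comp]
  simp only [Fintype.sum_prod_type]
  rfl

lemma sum_diophWeight_eq (r : F) :
    ∑ a, diophWeight r a = ∑ a, ∑ b, (1 + quadraticChar F (a * b + r)) *
      ∑ c, (1 + quadraticChar F (a * c + r)) * (1 + quadraticChar F (b * c + r)) := by
  simp only [Finset.mul_sum, ← mul_assoc]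
  exact sum_fin_three_arrow fun a b c => (1 + quadraticChar F (a * b + r)) *
    (1 + quadraticChar F (a * c + r)) * (1 + quadraticChar F (b * c + r))

lemma abs_sum_sum_one_add_quadraticChar_sub_card_sq_le (hF : ringChar F ≠ 2) (r : F) :
    |∑ a, ∑ b, (1 + quadraticChar F (a * b + r)) - (Fintype.card F : ℤ) ^ 2| ≤
      (Fintype.card F : ℤ) := by
  have expand : ∑ a, ∑ b, (1 + quadraticChar F (a * b + r)) - (Fintype.card F : ℤ) ^ 2 =
      ∑ a, ∑ b, quadraticChar F (a * b + r) := by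
    simp [Finset.sum_add_distrib, sq]
  calc |∑ a, ∑ b, (1 + quadraticChar F (a * b + r)) - (Fintype.card F : ℤ) ^ 2|
      ≤ ∑ a, |∑ b, quadraticChar F (a * b + r)| := by
        rw [expand]
        exact Finset.abs_sum_le_sum_abs _ _
    _ ≤ ∑ a : F, if a = 0 then (Fintype.card F : ℤ) else 0 :=
        Finset.sum_le_sum fun a _ => abs_sum_quadraticChar_mul_add_le hF a r
    _ = (Fintype.card F : ℤ) := by simp

lemma abs_sum_diophWeight_sub_card_cube_le (hF : ringChar F ≠ 2) {r : F} (hr : r ≠ 0) :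
    |∑ a, diophWeight r a - (Fintype.card F : ℤ) ^ 3| ≤ 9 * (Fintype.card F : ℤ) ^ 2 := by
  set q := (Fintype.card F : ℤ) with hq
  let inner (a b : F) : ℤ :=
    ∑ c, (1 + quadraticChar F (a * c + r)) * (1 + quadraticChar F (b * c + r))
  have hsplit : ∑ a, diophWeight r a - q ^ 3 =
      ∑ a, ∑ b, (1 + quadraticChar F (a * b + r)) * (inner a b - q) +
        q * (∑ a, ∑ b, (1 + quadraticChar F (a * b + r)) - q ^ 2) := by
    simp only [sum_diophWeight_eq, mul_sub, Finset.sum_sub_distrib, ← Finset.sum_mul]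
    ring
  have hinner (a b : F) : |(1 + quadraticChar F (a * b + r)) * (inner a b - q)| ≤
      2 * ((if a = 0 then q else 0) + (if b = 0 then q else 0) + (1 + if a = b then q else 0)) := by
    have h := one_add_quadraticChar_mem_Icc (a * b + r)
    rw [abs_mul, abs_of_nonneg h.1]
    exact mul_le_mul h.2 (abs_sum_one_add_quadraticChar_mul_sub_card_le hF hr a b)
      (abs_nonneg _) (by norm_num)
  have hfirst : |∑ a, ∑ b, (1 + quadraticChar F (a * b + r)) * (inner a b - q)| ≤ 8 * q ^ 2 :=
    calc _ ≤ ∑ a, ∑ b, |(1 + quadraticChar F (a * b + r)) * (inner a b - q)| :=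
          (Finset.abs_sum_le_sum_abs _ _).trans
            (Finset.sum_le_sum fun a _ => Finset.abs_sum_le_sum_abs _ _)
      _ ≤ ∑ a : F, ∑ b : F, 2 * ((if a = 0 then q else 0) + (if b = 0 then q else 0) +
            (1 + if a = b then q else 0)) :=
          Finset.sum_le_sum fun a _ => Finset.sum_le_sum fun b _ => hinner a b
      _ = 8 * q ^ 2 := by
          simp only [← Finset.mul_sum, Finset.sum_add_distrib, Finset.sum_const, Finset.card_univ,
            nsmul_eq_mul, ← hq, Finset.sum_ite_eq', Finset.sum_ite_eq, Finset.mem_univ, ↓reduceIte]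
          ring
  have hsecond : |q * (∑ a, ∑ b, (1 + quadraticChar F (a * b + r)) - q ^ 2)| ≤ q * q := by
    rw [abs_mul, abs_of_nonneg (by positivity : 0 ≤ q)]
    gcongr
    exact abs_sum_sum_one_add_quadraticChar_sub_card_sq_le hF r
  rw [hsplit]
  linarith [abs_add_le (∑ a, ∑ b, (1 + quadraticChar F (a * b + r)) * (inner a b - q))
    (q * (∑ a, ∑ b, (1 + quadraticChar F (a * b + r)) - q ^ 2))]

end Weight

lemma abs_eight_mul_ncard_diophTuples_three_sub_natCard_cube_le [Finite F] (hF : ringChar F ≠ 2)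
    {r : F} (hr : r ≠ 0) :
    |8 * ((diophTuples 3 F r).ncard : ℤ) - (Nat.card F : ℤ) ^ 3| ≤ 33 * (Nat.card F : ℤ) ^ 2 := by
  classical
  have := Fintype.ofFinite F
  have hweight := abs_sum_diophWeight_sub_card_cube_le hF hr
  rw [← Nat.card_eq_fintype_card, abs_le] at hweight
  have hlower := eight_mul_ncard_unitDiophTuples_le_sum_diophWeight r
  have hupper := sum_diophWeight_le_eight_mul_ncard_diophTuples r
  have hncard := Set.ncard_sdiff_add_ncard_of_subset (unitDiophTuples_subset_diophTuples 3 r)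
  have hsdiff : (diophTuples 3 F r \ unitDiophTuples 3 F r).ncard ≤ 3 * Nat.card F ^ 2 := by
    refine Nat.le_of_mul_le_mul_left
      ((natCard_mul_ncard_diophTuples_sdiff_le 3 hr).trans_eq ?_) Nat.card_pos
    rw [show Nat.choose 3 2 = 3 from rfl]
    ring
  zify at hncard hsdiff
  rw [abs_le]
  constructor <;> linarith

theorem abs_ncard_diophTuples_three_div_sub_le [Finite F] (hF : ringChar F ≠ 2) {r : F}
    (hr : r ≠ 0) :
    |((diophTuples 3 F r).ncard : ℝ) / (Nat.card F : ℝ) ^ 3 - 1 / 8| ≤ 5 / (Nat.card F : ℝ) := by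
  have hcount := abs_eight_mul_ncard_diophTuples_three_sub_natCard_cube_le hF hr
  have hq : (0 : ℝ) < Nat.card F := Nat.cast_pos.2 Nat.card_pos
  rify at hcount
  set N := ((diophTuples 3 F r).ncard : ℝ)
  set q := (Nat.card F : ℝ)
  calc |N / q ^ 3 - 1 / 8| = |(8 * N - q ^ 3) / (8 * q ^ 3)| := by
        congr 1
        field_simp
    _ = |8 * N - q ^ 3| / (8 * q ^ 3) := by
        rw [abs_div, abs_of_pos (by positivity : 0 < 8 * q ^ 3)]
    _ ≤ 40 * q ^ 2 / (8 * q ^ 3) := by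
        gcongr
        linarith [sq_nonneg q]
    _ = 5 / q := by
        field_simp
        norm_num

end DiophTuplesOverFiniteField

section Reduction

open IsLocalRing

lemma measureReal_preimage_eq_ncard_div {G H : Type*} [AddGroup G] [AddGroup H] [Finite H]
    [MeasurableSpace G] [MeasurableAdd G] (μ : Measure G) [IsProbabilityMeasure μ]
    [μ.IsAddLeftInvariant] {f : G →+ H} (hf : Function.Surjective f)
    (hker : MeasurableSet (f.ker : Set G)) (S : Set H) :
    μ.real (f ⁻¹' S) = S.ncard / Nat.card H := by
  classical
  have hfiber (g : G) : f ⁻¹' {f g} = (fun x => -g + x) ⁻¹' (f.ker : Set G) := by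
    ext x
    simp only [Set.mem_preimage, Set.mem_singleton_iff, SetLike.mem_coe, AddMonoidHom.mem_ker,
      map_add, map_neg, neg_add_eq_zero]
    exact eq_comm
  have hmeas (h : H) : MeasurableSet (f ⁻¹' {h}) := by
    obtain ⟨g, rfl⟩ := hf h
    rw [hfiber]
    exact measurable_const_add (-g) hker
  have hkernel : μ.real f.ker = 1 / Nat.card H := by
    have h := congrArg ENNReal.toReal (f.ker.index_mul_measure hker μ)
    rw [AddSubgroup.index_ker f, AddMonoidHom.range_eq_top.2 hf] at h
    rw [eq_div_iff (Nat.cast_ne_zero.2 Nat.card_pos.ne'), mul_comm]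
    simpa [measureReal_def] using h
  have hreal (h : H) : μ.real (f ⁻¹' {h}) = 1 / Nat.card H := by
    obtain ⟨g, rfl⟩ := hf h
    rw [hfiber, measureReal_def, measure_preimage_add, ← measureReal_def, hkernel]
  have := Fintype.ofFinite H
  have hsum := sum_measureReal_preimage_singleton (μ := μ) S.toFinset fun h _ => hmeas h
  rw [Set.coe_toFinset] at hsum
  rw [← hsum, Finset.sum_congr rfl fun h _ => hreal h, Finset.sum_const, nsmul_eq_mul,
    mul_one_div, Set.ncard_eq_toFinset_card']

lemma diophTuples_subset_preimage (m : ℕ) {R S : Type*} [CommRing R] [CommRing S] (f : R →+* S)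
    (r : R) : diophTuples m R r ⊆ (f ∘ ·) ⁻¹' diophTuples m S (f r) := by
  intro a ha i j hij
  simpa using (ha i j hij).map f

variable {R : Type*} [CommRing R]

section LocalRing

variable [IsLocalRing R] [TopologicalSpace R] [IsTopologicalRing R]

lemma finite_residueField_of_isOpen_maximalIdeal [CompactSpace R]
    (hm : IsOpen (maximalIdeal R : Set R)) : Finite (ResidueField R) :=
  (maximalIdeal R).toAddSubgroup.quotient_finite_of_isOpen hm

lemma measureReal_pi_preimage_residue [MeasurableSpace R] [BorelSpace R] [Finite (ResidueField R)]
    (hm : IsOpen (maximalIdeal R : Set R)) (μ : Measure R) [IsProbabilityMeasure μ]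
    [μ.IsAddLeftInvariant] {ι : Type*} [Fintype ι] (S : Set (ι → ResidueField R)) :
    (Measure.pi fun _ : ι => μ).real ((residue R ∘ ·) ⁻¹' S) =
      S.ncard / (Nat.card (ResidueField R) : ℝ) ^ Fintype.card ι := by
  let f : (ι → R) →+ (ι → ResidueField R) := (residue R).toAddMonoidHom.compLeft ι
  have hker : (f.ker : Set (ι → R)) = Set.univ.pi fun _ => (maximalIdeal R : Set R) := by
    ext a
    simp only [SetLike.mem_coe, AddMonoidHom.mem_ker, Set.mem_univ_pi, ← residue_eq_zero_iff]
    exact funext_iff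
  have h := measureReal_preimage_eq_ncard_div (Measure.pi fun _ : ι => μ)
    (f := f) residue_surjective.comp_left
    (hker ▸ MeasurableSet.univ_pi fun _ => hm.measurableSet) S
  rwa [Nat.card_fun, Nat.card_eq_fintype_card (α := ι), Nat.cast_pow] at h

end LocalRing

variable [HenselianLocalRing R]

lemma isSquare_of_isSquare_residue (h2 : ringChar (ResidueField R) ≠ 2) {u : R} (hu : IsUnit u)
    (hsq : IsSquare (residue R u)) : IsSquare u := by
  obtain ⟨y, hy⟩ := hsq
  obtain ⟨b, rfl⟩ := residue_surjective y
  have hb : residue R b ≠ 0 := by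
    intro h
    exact (residue_ne_zero_iff_isUnit u).2 hu (by rw [hy, h, mul_zero])
  have hroot : (Polynomial.X ^ 2 - Polynomial.C u).eval b ∈ maximalIdeal R := by
    rw [← residue_eq_zero_iff]
    simp [hy, sq]
  have hsimple : IsUnit ((Polynomial.X ^ 2 - Polynomial.C u).derivative.eval b) := by
    rw [← residue_ne_zero_iff_isUnit]
    have hderiv : residue R ((Polynomial.X ^ 2 - Polynomial.C u).derivative.eval b) =
        2 * residue R b := by
      simp [one_add_one_eq_two, map_ofNat (residue R) 2]
    rw [hderiv]
    exact mul_ne_zero (Ring.two_ne_zero h2) hb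
  obtain ⟨a, ha, -⟩ := HenselianLocalRing.is_henselian _
    (Polynomial.monic_X_pow_sub_C u two_ne_zero) b hroot hsimple
  exact ⟨a, by simpa [sub_eq_zero, sq, eq_comm] using ha⟩

lemma preimage_residue_unitDiophTuples_subset (m : ℕ) (h2 : ringChar (ResidueField R) ≠ 2)
    (r : R) :
    (residue R ∘ ·) ⁻¹' unitDiophTuples m (ResidueField R) (residue R r) ⊆ diophTuples m R r := by
  intro a ha i j hij
  obtain ⟨hunit, hsq⟩ := ha i j hij
  simp only [Function.comp_apply, ← map_mul, ← map_add] at hunit hsq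
  exact isSquare_of_isSquare_residue h2 (isUnit_of_map_unit (residue R) _ hunit) hsq

variable [TopologicalSpace R] [IsTopologicalRing R] [CompactSpace R]

theorem abs_diophMeasure_sub_ncard_div_le (m : ℕ) (hm : IsOpen (maximalIdeal R : Set R))
    (h2 : ringChar (ResidueField R) ≠ 2) {r : R} (hr : IsUnit r) :
    |diophMeasure m R r - (diophTuples m (ResidueField R) (residue R r)).ncard /
        (Nat.card (ResidueField R) : ℝ) ^ m| ≤
      m.choose 2 / Nat.card (ResidueField R) := by
  let : MeasurableSpace R := borel R
  have : BorelSpace R := ⟨rfl⟩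
  let μ : Measure R := Measure.addHaarMeasure (⊤ : TopologicalSpace.PositiveCompacts R)
  have : IsProbabilityMeasure μ := ⟨Measure.addHaarMeasure_self⟩
  have := finite_residueField_of_isOpen_maximalIdeal hm
  set q := Nat.card (ResidueField R)
  set D := diophTuples m (ResidueField R) (residue R r)
  set U := unitDiophTuples m (ResidueField R) (residue R r)
  have hq : (0 : ℝ) < q := mod_cast Nat.card_pos
  have hpreimage (S : Set (Fin m → ResidueField R)) :
      (Measure.pi fun _ : Fin m => μ).real ((residue R ∘ ·) ⁻¹' S) = S.ncard / (q : ℝ) ^ m := by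
    simpa using measureReal_pi_preimage_residue hm μ S
  have hupper : diophMeasure m R r ≤ D.ncard / (q : ℝ) ^ m :=
    (measureReal_mono (diophTuples_subset_preimage m (residue R) r)).trans_eq (hpreimage D)
  have hlower : U.ncard / (q : ℝ) ^ m ≤ diophMeasure m R r :=
    (hpreimage U).symm.trans_le (measureReal_mono (preimage_residue_unitDiophTuples_subset m h2 r))
  have hdiff : (D.ncard : ℝ) / (q : ℝ) ^ m - U.ncard / (q : ℝ) ^ m ≤ m.choose 2 / q := by
    have hsdiff := natCard_mul_ncard_diophTuples_sdiff_le m ((residue_ne_zero_iff_isUnit r).2 hr)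
    have hncard := Set.ncard_sdiff_add_ncard_of_subset
      (unitDiophTuples_subset_diophTuples m (residue R r))
    rw [← sub_div, div_le_div_iff₀ (by positivity) hq, ← hncard, Nat.cast_add, add_sub_cancel_right,
      mul_comm]
    exact_mod_cast hsdiff
  rw [abs_le]
  constructor <;> linarith

theorem abs_diophMeasure_three_sub_le (hm : IsOpen (maximalIdeal R : Set R))
    (h2 : ringChar (ResidueField R) ≠ 2) {r : R} (hr : IsUnit r) :
    |diophMeasure 3 R r - 1 / 8| ≤ 8 / Nat.card (ResidueField R) := by
  have := finite_residueField_of_isOpen_maximalIdeal hm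
  have hlift := abs_diophMeasure_sub_ncard_div_le 3 hm h2 hr
  have hcount := abs_ncard_diophTuples_three_div_sub_le h2
    ((residue_ne_zero_iff_isUnit r).2 hr)
  calc |diophMeasure 3 R r - 1 / 8|
      ≤ (Nat.choose 3 2 : ℝ) / Nat.card (ResidueField R) + 5 / Nat.card (ResidueField R) :=
        (abs_sub_le _ _ _).trans (add_le_add hlift hcount)
    _ = 8 / Nat.card (ResidueField R) := by
        rw [← add_div]
        norm_num [Nat.choose]

end Reduction

section ResidueCharacteristic

lemma isUnit_intCast_of_natAbs_lt_ringChar {R : Type*} [CommRing R] [IsLocalRing R] {r : ℤ}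
    (hr : r ≠ 0) (h : r.natAbs < ringChar (IsLocalRing.ResidueField R)) : IsUnit (r : R) := by
  rw [← IsLocalRing.residue_ne_zero_iff_isUnit, map_intCast, Ne,
    CharP.intCast_eq_zero_iff _ (ringChar (IsLocalRing.ResidueField R))]
  exact fun hdvd => hr (Int.eq_zero_of_dvd_of_natAbs_lt_natAbs hdvd (by simpa using h))

lemma ringChar_le_natCard (R : Type*) [Ring R] [Finite R] : ringChar R ≤ Nat.card R := by
  have := Fintype.ofFinite R
  exact Nat.le_of_dvd Nat.card_pos (ringChar.dvd (by simp))

lemma isBigO_one_div_natCard_one_div_ringChar {ι : Type*} (l : Filter ι) (R : ι → Type*)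
    [∀ i, Ring (R i)] [∀ i, Finite (R i)] :
    (fun i => 1 / (Nat.card (R i) : ℝ)) =O[l] (fun i => 1 / (ringChar (R i) : ℝ)) := by
  refine .of_norm_le fun i => ?_
  have hpos : 0 < ringChar (R i) := Nat.pos_of_ne_zero (CharP.ringChar_ne_zero_of_finite (R i))
  rw [Real.norm_of_nonneg (by positivity)]
  gcongr
  exact ringChar_le_natCard (R i)

variable (K : Type*) [Field K] [ValuativeRel K] [TopologicalSpace K] [IsNonarchimedeanLocalField K]

lemma isOpen_maximalIdeal_integer : IsOpen (𝓂[K] : Set 𝒪[K]) := by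
  let := IsTopologicalAddGroup.rightUniformSpace K
  have := isUniformAddGroup_of_addCommGroup (G := K)
  exact IsLocalRing.isOpen_maximalIdeal 𝒪[K]

lemma henselianLocalRing_integer : HenselianLocalRing 𝒪[K] where
  is_henselian f hf a ha hfa := by
    let := IsTopologicalAddGroup.rightUniformSpace K
    have := isUniformAddGroup_of_addCommGroup (G := K)
    exact HenselianRing.is_henselian (I := 𝓂[K]) f hf a ha (hfa.map _)

end ResidueCharacteristic

theorem mainTheorem11_general {ι : Type*} {l : Filter ι} (R : ι → Type*) [∀ i, CommRing (R i)]
    [∀ i, HenselianLocalRing (R i)] [∀ i, TopologicalSpace (R i)] [∀ i, IsTopologicalRing (R i)]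
    [∀ i, CompactSpace (R i)] (hm : ∀ i, IsOpen (IsLocalRing.maximalIdeal (R i) : Set (R i)))
    (h2 : ∀ᶠ i in l, ringChar (IsLocalRing.ResidueField (R i)) ≠ 2)
    (r : ∀ i, R i) (hr : ∀ᶠ i in l, IsUnit (r i)) :
    (fun i => diophMeasure 3 (R i) (r i) - 1 / 8) =O[l]
      (fun i => 1 / (Nat.card (IsLocalRing.ResidueField (R i)) : ℝ)) := by
  refine Asymptotics.IsBigO.of_bound 8 ?_
  filter_upwards [h2, hr] with i h2i hri
  rw [Real.norm_eq_abs, Real.norm_of_nonneg (by positivity), mul_one_div]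
  exact abs_diophMeasure_three_sub_le (hm i) h2i hri

theorem mainTheorem11 (K : ℕ → Type*) [∀ i, Field (K i)] [∀ i, CharZero (K i)]
    [∀ i, ValuativeRel (K i)] [∀ i, TopologicalSpace (K i)]
    [∀ i, IsNonarchimedeanLocalField (K i)]
    (hp : Filter.Tendsto (fun i => ringChar 𝓀[K i]) Filter.atTop Filter.atTop)
    (r : ℤ) (hr : r ≠ 0) :
    (fun i => diophMeasure 3 𝒪[K i] (r : 𝒪[K i]) - 1 / 8) =O[Filter.atTop]
      (fun i => 1 / (ringChar 𝓀[K i] : ℝ)) := by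
  have (i : ℕ) := henselianLocalRing_integer (K i)
  exact (mainTheorem11_general (fun i => 𝒪[K i]) (fun i => isOpen_maximalIdeal_integer (K i))
    (hp.eventually_ne_atTop 2) (fun i => (r : 𝒪[K i])) <| (hp.eventually_gt_atTop r.natAbs).mono
      fun i => isUnit_intCast_of_natAbs_lt_ringChar hr).trans <|
    isBigO_one_div_natCard_one_div_ringChar _ _
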